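/- Let $n\ge 1$, let $\mathcal H_1,\dots,\mathcal H_n$ be finite-dimensional complex Hilbert spaces, and let $\mathcal H=\bigotimes_{j=1}^n\mathcal H_j$. A state on $\mathcal H$ is a positive semidefinite operator of trace one. It is separable if it is a finite sum $\sigma=\sum_i q_i\bigotimes_{j=1}^n|\phi_i^{(j)}\rangle\langle\phi_i^{(j)}|$ with $q_i\ge 0$, $\sum_i q_i=1$ and unit vectors $\phi_i^{(j)}\in\mathcal H_j$; let $S$ be the set of separable states. For states $\rho,\sigma$ let $F(\rho,\sigma)=\big(\mathrm{Tr}\sqrt{\sqrt\rho\,\sigma\sqrt\rho}\big)^2$, and define the fidelity of separability by $F_s(\rho)=\max_{\sigma\in S}F(\rho,\sigma)$, with $F_s(|\psi\rangle)=F_s(|\psi\rangle\langle\psi|)$ for a unit vector $\psi$. Then, for every state $\rho$ on $\mathcal H$, the maximum defining $F_s(\rho)$ is attained, and $$F_s(\rho)=\max_{\{p_i,|\psi_i\rangle\}}\sum_i p_i\,F_s(|\psi_i\rangle),$$ where the maximum is taken over all finite pure-state decompositions $\rho=\sum_i p_i|\psi_i\rangle\langle\psi_i|$ of $\rho$, with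 $p_i\ge0$, $\sum_i p_i=1$ and unit vectors $\psi_i\in\mathcal H$, and is attained. -/

import Mathlib

open scoped ComplexOrder MatrixOrder

namespace QSep

/-- The Hilbert space with orthonormal basis indexed by the finite type `X`. The party `j` has the
space `Hilb (d j)`, and `Hilb (∀ j, d j)` is the tensor product of the spaces of all parties (its
standard basis consists of the products of the standard basis vectors). -/
abbrev Hilb (X : Type*) [Fintype X] : Type _ := EuclideanSpace ℂ X

section States

variable {X : Type*} [Fintype X] [DecidableEq X]

/-- Density matrices: positive semidefinite of trace one. -/
def IsDensity (ρ : Matrix X X ℂ) : Prop :=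
  ρ.PosSemidef ∧ ρ.trace = 1

/-- The rank-one operator `|ψ⟩⟨ψ|`, with entries `ψ x * conj (ψ y)`. -/
def ketbra (ψ : Hilb X) : Matrix X X ℂ :=
  Matrix.of fun x y => ψ x * star (ψ y)

/-- Uhlmann's fidelity `(Tr √(√ρ σ √ρ))²`. The trace is a nonnegative real number, the trace of a
positive semidefinite square root. -/
noncomputable def fidelity (ρ σ : Matrix X X ℂ) : ℝ :=
  (CFC.sqrt (CFC.sqrt ρ * σ * CFC.sqrt ρ)).trace.re ^ 2

/-- A finite pure-state decomposition `ρ = ∑ i, p i |ψ i⟩⟨ψ i|` into unit vectors. -/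
structure IsPureDecomposition (ρ : Matrix X X ℂ) {m : ℕ} (p : Fin m → ℝ) (ψ : Fin m → Hilb X) :
    Prop where
  nonneg : ∀ i, 0 ≤ p i
  sum_eq_one : ∑ i, p i = 1
  norm_eq_one : ∀ i, ‖ψ i‖ = 1
  eq_sum : ρ = ∑ i, (p i : ℂ) • ketbra (ψ i)

end States

section Multipartite

variable {n : ℕ} {d : Fin n → Type*} [∀ j, Fintype (d j)] [∀ j, DecidableEq (d j)]

/-- The tensor product of one operator on each party. -/
def tensorOp (A : ∀ j, Matrix (d j) (d j) ℂ) : Matrix (∀ j, d j) (∀ j, d j) ℂ :=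
  Matrix.of fun x y => ∏ j, A j (x j) (y j)

/-- Separable states: finite convex combinations of tensor products of pure states of the
parties. -/
def IsSeparable (σ : Matrix (∀ j, d j) (∀ j, d j) ℂ) : Prop :=
  ∃ (m : ℕ) (q : Fin m → ℝ) (φ : Fin m → ∀ j, Hilb (d j)),
    (∀ i, 0 ≤ q i) ∧ ∑ i, q i = 1 ∧ (∀ i j, ‖φ i j‖ = 1) ∧
      σ = ∑ i, (q i : ℂ) • tensorOp fun j => ketbra (φ i j)

/-- The values of the fidelity between `ρ` and separable states. -/
def sepFidelities (ρ : Matrix (∀ j, d j) (∀ j, d j) ℂ) : Set ℝ :=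
  {v | ∃ σ, IsSeparable σ ∧ v = fidelity ρ σ}

/-- The fidelity of separability (the theorem says that the supremum is attained). -/
noncomputable def fidelityOfSeparability (ρ : Matrix (∀ j, d j) (∀ j, d j) ℂ) : ℝ :=
  sSup (sepFidelities ρ)

/-- The values `∑ i, p i * F_s(|ψ i⟩⟨ψ i|)` over all pure-state decompositions of `ρ`. -/
def decompositionValues (ρ : Matrix (∀ j, d j) (∀ j, d j) ℂ) : Set ℝ :=
  {v | ∃ (m : ℕ) (p : Fin m → ℝ) (ψ : Fin m → Hilb (∀ j, d j)), IsPureDecomposition ρ p ψ ∧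
    v = ∑ i, p i * fidelityOfSeparability (ketbra (ψ i))}

end Multipartite

end QSep

/-! Uhlmann's theorem, in factored form, turns fidelity into overlaps: `Re ∑ ⟨a i, b i⟩` is at most
the root fidelity of `∑ |a i⟩⟨a i|` and `∑ |b i⟩⟨b i|` (`re_sum_inner_le_rootFidelity`). For fixed
`b` equality is reached by suitable `a`, once extra vectors `c` may complete the decomposition of
`ρ` (`exists_sum_ketbra_re_sum_inner_eq`). Against a pure state the fidelity is affine in `σ`, so
there a product vector is already optimal.

Given a decomposition of `ρ`, mix the optimal product vectors of its members with weights
proportional to `p i * F_s(ψ i)`; the overlap bound shows that this separable state has fidelity at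
least `∑ p i * F_s(ψ i)`. Conversely, an optimal separable `σ` induces through the equality case a
decomposition of `ρ`, and Cauchy–Schwarz bounds `F(ρ, σ)` by its mean. Maxima exist because the
separable states are compact and the fidelity is continuous on them. -/

/-- In finite dimension, the convex hull of a compact set is compact. -/
theorem IsCompact.convexHull_of_finiteDimensional {E : Type*} [AddCommGroup E] [Module ℝ E]
    [TopologicalSpace E] [IsTopologicalAddGroup E] [ContinuousSMul ℝ E] [FiniteDimensional ℝ E]
    {s : Set E} (hs : IsCompact s) :
    IsCompact (convexHull ℝ s) := by
  rcases s.eq_empty_or_nonempty with rfl | ⟨e, he⟩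
  · simp
  -- Carathéodory: `N` points always suffice, so the hull is a continuous image of a compact set.
  set N := Module.finrank ℝ E + 1
  have hc : IsCompact ((fun q : (Fin N → ℝ) × (Fin N → E) => ∑ i, q.1 i • q.2 i) ''
      (stdSimplex ℝ (Fin N) ×ˢ Set.univ.pi fun _ => s)) :=
    ((isCompact_stdSimplex ℝ (Fin N)).prod (isCompact_univ_pi fun _ => hs)).image (by fun_prop)
  convert hc
  apply Set.Subset.antisymm
  · intro x hx
    obtain ⟨ι, _, z, w, hz, ha, hw, hw1, rfl⟩ := eq_pos_convex_span_of_mem_convexHull hx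
    have hcard : Fintype.card ι ≤ N := by
      refine ha.card_le_finrank_succ.trans ?_
      exact Nat.succ_le_succ (Submodule.finrank_le _)
    obtain ⟨f⟩ : Nonempty (ι ↪ Fin N) :=
      Function.Embedding.nonempty_of_card_le (by simpa using hcard)
    -- Shorter combinations are padded to length `N` with weight `0` at the point `e`.
    refine ⟨(Function.extend f w 0, Function.extend f z fun _ => e), ⟨⟨?_, ?_⟩, ?_⟩, ?_⟩
    · intro i
      by_cases hi : ∃ a, f a = i
      · obtain ⟨a, rfl⟩ := hi
        simpa [f.injective.extend_apply] using (hw a).le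
      · simp [Function.extend_apply' _ _ _ hi]
    · rw [← hw1]
      symm
      refine Fintype.sum_of_injective f f.injective _ _ (fun i hi => ?_) fun a => ?_
      · simp [Function.extend_apply' _ _ _ (by simpa using hi)]
      · simp [f.injective.extend_apply]
    · intro i _
      by_cases hi : ∃ a, f a = i
      · obtain ⟨a, rfl⟩ := hi
        simpa [f.injective.extend_apply] using hz ⟨a, rfl⟩
      · simpa [Function.extend_apply' _ _ _ hi] using he
    · symm
      refine Fintype.sum_of_injective f f.injective _ _ (fun i hi => ?_) fun a => ?_
      · simp [Function.extend_apply' _ _ _ (by simpa using hi)]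
      · simp [f.injective.extend_apply]
  · rintro _ ⟨⟨w, z⟩, ⟨⟨hw, hw1⟩, hz⟩, rfl⟩
    exact (convex_convexHull ℝ s).sum_mem (fun i _ => hw i) hw1
      fun i _ => subset_convexHull ℝ s (hz i trivial)

/-! ### Polar decomposition and Uhlmann's theorem -/

namespace QSep

theorem re_trace_conjTranspose_mul_le {X ι : Type*} [Fintype X] [Fintype ι] (C D : Matrix X ι ℂ) :
    2 * (C.conjTranspose * D).trace.re ≤
      (C.conjTranspose * C).trace.re + (D.conjTranspose * D).trace.re := by
  have h := (Complex.le_def.1 (Matrix.posSemidef_conjTranspose_mul_self (C - D)).trace_nonneg).1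
  have h2 : (D.conjTranspose * C).trace.re = (C.conjTranspose * D).trace.re := by
    rw [show D.conjTranspose * C = (C.conjTranspose * D).conjTranspose by
      simp [Matrix.conjTranspose_mul], Matrix.trace_conjTranspose]
    simp
  simp only [Matrix.conjTranspose_sub, Matrix.sub_mul, Matrix.mul_sub, Matrix.trace_sub,
    Complex.sub_re, Complex.zero_re, h2] at h
  linarith

section Matrices

variable {X ι : Type*} [Fintype X] [DecidableEq X] [Fintype ι]

/-- Polar decomposition: `M = S V` with `V` a partial isometry whose range projection is the
support of `S`. -/
theorem exists_polar {S : Matrix X X ℂ} (hS : S.IsHermitian) {M : Matrix X ι ℂ}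
    (hM : M * M.conjTranspose = S * S) :
    ∃ V : Matrix X ι ℂ, M = S * V ∧ S * (V * V.conjTranspose) = S ∧
      (V * V.conjTranspose) * (V * V.conjTranspose) = V * V.conjTranspose := by
  have hsa : IsSelfAdjoint S := hS
  have hc (f : ℝ → ℝ) : ContinuousOn f (spectrum ℝ S) := S.finite_real_spectrum.continuousOn f
  obtain ⟨T, hTT, hTS, hSTS⟩ : ∃ T : Matrix X X ℂ, T.conjTranspose = T ∧ T * S = S * T ∧
      S * T * S = S := by
    have hid : cfc (fun x : ℝ => x) S = S := cfc_id' ℝ S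
    -- Since `0⁻¹ = 0`, this is the pseudoinverse of `S`, and `S * T` is the projection onto its
    -- support.
    refine ⟨cfc (fun x : ℝ => x⁻¹) S, ?_, ?_, ?_⟩
    · exact cfc_predicate (fun x : ℝ => x⁻¹) S
    · have := (cfc_commute_cfc (fun x : ℝ => x⁻¹) (fun x => x) S).eq
      rwa [hid] at this
    · nth_rw 1 3 [← hid]
      rw [← cfc_mul _ _ S (hc _) (hc _), ← cfc_mul _ _ S (hc _) (hc _)]
      simp only [mul_inv_mul_cancel, hid]
  have hST : (S * T).conjTranspose = S * T := by
    rw [Matrix.conjTranspose_mul, hTT, hS.eq, hTS]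
  have hVV : (T * M) * (T * M).conjTranspose = S * T := by
    rw [Matrix.conjTranspose_mul, hTT, Matrix.mul_assoc, ← Matrix.mul_assoc M, hM]
    calc T * (S * S * T) = T * S * (S * T) := by simp only [Matrix.mul_assoc]
      _ = S * T * S * T := by rw [hTS]; simp only [Matrix.mul_assoc]
      _ = S * T := by rw [hSTS]
  refine ⟨T * M, ?_, ?_, ?_⟩
  · rw [← sub_eq_zero, ← Matrix.self_mul_conjTranspose_eq_zero]
    have h1 : M - S * (T * M) = (1 - S * T) * M := by
      rw [Matrix.sub_mul, Matrix.one_mul, Matrix.mul_assoc]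
    have h2 : (1 - S * T) * S = 0 := by rw [Matrix.sub_mul, Matrix.one_mul, hSTS, sub_self]
    rw [h1, Matrix.conjTranspose_mul, Matrix.mul_assoc, ← Matrix.mul_assoc M, hM,
      Matrix.mul_assoc S, ← Matrix.mul_assoc, h2, Matrix.zero_mul]
  · rw [hVV, ← hTS, ← Matrix.mul_assoc, hSTS]
  · rw [hVV, ← Matrix.mul_assoc, hSTS]

/-- `P = W Wᴴ` is a projection, and the difference of the two sides is the trace of `Q (1 - P) Q ≥
0`. -/
theorem re_trace_compress_le {Q : Matrix X X ℂ} (hQ : Q.IsHermitian) {W : Matrix X ι ℂ}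
    (hW : (W * W.conjTranspose) * (W * W.conjTranspose) = W * W.conjTranspose) :
    ((Q * W).conjTranspose * (Q * W)).trace.re ≤ (Q * Q).trace.re := by
  set P := W * W.conjTranspose with hP
  have hPh : P.conjTranspose = P := by simp [hP, Matrix.conjTranspose_mul]
  have h := (Complex.le_def.1
    (Matrix.posSemidef_self_mul_conjTranspose (Q * (1 - P))).trace_nonneg).1
  have h1 : Q * (1 - P) * (Q * (1 - P)).conjTranspose = Q * Q - Q * P * Q := by
    rw [Matrix.conjTranspose_mul, Matrix.conjTranspose_sub, hPh, hQ.eq, Matrix.conjTranspose_one]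
    have : (1 - P) * (1 - P) = 1 - P := by
      rw [Matrix.sub_mul, Matrix.mul_sub, Matrix.mul_sub, hW]; simp
    rw [Matrix.mul_assoc, ← Matrix.mul_assoc (1 - P), this, Matrix.sub_mul, Matrix.mul_sub,
      Matrix.one_mul]
    simp only [Matrix.mul_assoc]
  have h2 : ((Q * W).conjTranspose * (Q * W)).trace = (Q * P * Q).trace := by
    rw [Matrix.trace_mul_comm, Matrix.conjTranspose_mul, hQ.eq, hP]
    simp only [Matrix.mul_assoc]
  rw [h1, Matrix.trace_sub, Complex.sub_re, Complex.zero_re] at h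
  rw [h2]
  linarith

/-- The square root of the fidelity. -/
noncomputable def rootFidelity (ρ σ : Matrix X X ℂ) : ℝ :=
  (CFC.sqrt (CFC.sqrt ρ * σ * CFC.sqrt ρ)).trace.re

theorem fidelity_eq_sq (ρ σ : Matrix X X ℂ) : fidelity ρ σ = rootFidelity ρ σ ^ 2 := rfl

theorem isHermitian_sqrt (A : Matrix X X ℂ) : (CFC.sqrt A).IsHermitian :=
  (Matrix.nonneg_iff_posSemidef.1 (CFC.sqrt_nonneg A)).isHermitian

theorem rootFidelity_nonneg (ρ σ : Matrix X X ℂ) : 0 ≤ rootFidelity ρ σ :=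
  (Complex.le_def.1 (Matrix.nonneg_iff_posSemidef.1
    (CFC.sqrt_nonneg (CFC.sqrt ρ * σ * CFC.sqrt ρ))).trace_nonneg).1

theorem sandwich_nonneg (ρ : Matrix X X ℂ) {σ : Matrix X X ℂ} (hσ : σ.PosSemidef) :
    0 ≤ CFC.sqrt ρ * σ * CFC.sqrt ρ := by
  have := hσ.conjTranspose_mul_mul_same (CFC.sqrt ρ)
  rw [(isHermitian_sqrt ρ).eq] at this
  exact this.nonneg

/-- For `σ = B Bᴴ`, the operator `√ρ B` has the polar decomposition `√(√ρ σ √ρ) V`. -/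
theorem exists_polar_sqrt_mul (ρ : Matrix X X ℂ) (B : Matrix X ι ℂ) :
    ∃ V : Matrix X ι ℂ,
      CFC.sqrt ρ * B = CFC.sqrt (CFC.sqrt ρ * (B * B.conjTranspose) * CFC.sqrt ρ) * V ∧
      CFC.sqrt (CFC.sqrt ρ * (B * B.conjTranspose) * CFC.sqrt ρ) * (V * V.conjTranspose) =
        CFC.sqrt (CFC.sqrt ρ * (B * B.conjTranspose) * CFC.sqrt ρ) ∧
      (V * V.conjTranspose) * (V * V.conjTranspose) = V * V.conjTranspose := by
  refine exists_polar (isHermitian_sqrt _) ?_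
  rw [CFC.sqrt_mul_sqrt_self _ (sandwich_nonneg ρ (Matrix.posSemidef_self_mul_conjTranspose B)),
    Matrix.conjTranspose_mul, (isHermitian_sqrt ρ).eq]
  simp only [Matrix.mul_assoc]

/-- One half of Uhlmann's theorem: the overlap of two factorizations is at most the root
fidelity. -/
theorem re_trace_le_rootFidelity (A B : Matrix X ι ℂ) :
    (A.conjTranspose * B).trace.re ≤
      rootFidelity (A * A.conjTranspose) (B * B.conjTranspose) := by
  have hρ := (Matrix.posSemidef_self_mul_conjTranspose A).nonneg
  set ρ := A * A.conjTranspose with hρA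
  obtain ⟨W, hW, -, hWW⟩ := exists_polar (isHermitian_sqrt ρ)
    (M := A) (by rw [CFC.sqrt_mul_sqrt_self ρ hρ])
  obtain ⟨V, hV, -, hVV⟩ := exists_polar_sqrt_mul ρ B
  unfold rootFidelity
  set S := CFC.sqrt (CFC.sqrt ρ * (B * B.conjTranspose) * CFC.sqrt ρ) with hS
  have hSQ := CFC.sqrt_mul_sqrt_self S (CFC.sqrt_nonneg _)
  set Q := CFC.sqrt S with hQ
  have hQh : Q.IsHermitian := isHermitian_sqrt S
  -- Splitting `S = Q Q` evenly between the two partial isometries makes each squared term at most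
  -- `Tr S`.
  have h1 : A.conjTranspose * B = (Q * W).conjTranspose * (Q * V) := by
    rw [hW, Matrix.conjTranspose_mul, Matrix.conjTranspose_mul, (isHermitian_sqrt ρ).eq, hQh.eq,
      Matrix.mul_assoc, hV, Matrix.mul_assoc, ← Matrix.mul_assoc Q, hSQ]
  have h2 := re_trace_conjTranspose_mul_le (Q * W) (Q * V)
  have h3 := re_trace_compress_le hQh hWW
  have h4 := re_trace_compress_le hQh hVV
  rw [hSQ] at h3 h4
  rw [h1]
  linarith

/-- The other half of Uhlmann's theorem: the root fidelity is an overlap of factorizations, where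
that of `ρ` may need additional columns. -/
theorem exists_factor_trace_eq_rootFidelity {ρ : Matrix X X ℂ} (hρ : ρ.PosSemidef)
    (B : Matrix X ι ℂ) :
    ∃ (A : Matrix X ι ℂ) (C : Matrix X X ℂ),
      A * A.conjTranspose + C * C.conjTranspose = ρ ∧
      (A.conjTranspose * B).trace.re = rootFidelity ρ (B * B.conjTranspose) := by
  obtain ⟨V, hV, hSV, hVV⟩ := exists_polar_sqrt_mul ρ B
  have hR := CFC.sqrt_mul_sqrt_self ρ hρ.nonneg
  have hRh := (isHermitian_sqrt ρ).eq
  unfold rootFidelity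
  set S := CFC.sqrt (CFC.sqrt ρ * (B * B.conjTranspose) * CFC.sqrt ρ) with hS
  set R := CFC.sqrt ρ with hRdef
  -- `V Vᴴ` may be a proper projection; the second factor restores the part of `ρ` that it cuts off.
  refine ⟨R * V, R * (1 - V * V.conjTranspose), ?_, ?_⟩
  · have h1 : (1 - V * V.conjTranspose) * (1 - V * V.conjTranspose) =
        1 - V * V.conjTranspose := by
      rw [Matrix.sub_mul, Matrix.mul_sub, Matrix.mul_sub, hVV]; simp
    have h2 : (1 - V * V.conjTranspose).conjTranspose = 1 - V * V.conjTranspose := by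
      simp [Matrix.conjTranspose_mul]
    rw [Matrix.conjTranspose_mul, Matrix.conjTranspose_mul, hRh, h2,
      Matrix.mul_assoc R (1 - _), ← Matrix.mul_assoc (1 - _), h1,
      Matrix.mul_assoc, ← Matrix.mul_assoc V, ← Matrix.mul_add, ← Matrix.add_mul,
      add_sub_cancel, Matrix.one_mul, hR]
  · rw [Matrix.conjTranspose_mul, hRh, Matrix.mul_assoc, hV, Matrix.trace_mul_comm,
      Matrix.mul_assoc, hSV]

open scoped Matrix.Norms.L2Operator in
theorem continuousOn_sqrt :
    ContinuousOn (CFC.sqrt : Matrix X X ℂ → Matrix X X ℂ) {A | 0 ≤ A} := by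
  rw [show (CFC.sqrt : Matrix X X ℂ → Matrix X X ℂ) = fun A => cfc NNReal.sqrt A from
    funext fun A => CFC.sqrt_eq_cfc]
  exact continuousOn_id.cfc_nnreal_of_mem_nhdsSet (s := Set.univ) NNReal.sqrt
    (by simp) (fun _ h => h) (by fun_prop)

theorem continuousOn_fidelity (ρ : Matrix X X ℂ) :
    ContinuousOn (fidelity ρ) {σ | σ.PosSemidef} := by
  have h : ContinuousOn (fun σ => CFC.sqrt (CFC.sqrt ρ * σ * CFC.sqrt ρ))
      {σ : Matrix X X ℂ | σ.PosSemidef} :=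
    continuousOn_sqrt.comp
      ((continuous_const.matrix_mul continuous_id).matrix_mul continuous_const).continuousOn
      fun σ hσ => sandwich_nonneg ρ hσ
  exact (Complex.continuous_re.comp_continuousOn
    ((continuous_id.matrix_trace).comp_continuousOn h)).pow 2

end Matrices

/-! ### Factorizations as families of vectors; pure states -/

section Vectors

variable {X ι κ : Type*} [Fintype X] [DecidableEq X] [Fintype ι] [Fintype κ]

/-- The matrix with the given vectors as columns. -/
def columns {X ι : Type*} [Fintype X] (v : ι → Hilb X) : Matrix X ι ℂ :=
  Matrix.of fun x i => v i x

theorem columns_mul_conjTranspose {X ι : Type*} [Fintype X] [Fintype ι] (v : ι → Hilb X) :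
    columns v * (columns v).conjTranspose = ∑ i, ketbra (v i) := by
  ext x y
  simp [Matrix.mul_apply, columns, ketbra, Matrix.sum_apply]

theorem trace_columns_conjTranspose_mul {X ι : Type*} [Fintype X] [Fintype ι]
    (a b : ι → Hilb X) :
    ((columns a).conjTranspose * columns b).trace = ∑ i, inner ℂ (a i) (b i) := by
  simp [Matrix.trace, Matrix.mul_apply, columns, PiLp.inner_apply, mul_comm]

theorem exists_columns_eq {X ι : Type*} [Fintype X] (A : Matrix X ι ℂ) :
    ∃ v : ι → Hilb X, columns v = A :=
  ⟨fun i => WithLp.toLp 2 fun x => A x i, rfl⟩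

theorem re_sum_inner_le_rootFidelity (a b : ι → Hilb X) :
    (∑ i, inner ℂ (a i) (b i)).re ≤
      rootFidelity (∑ i, ketbra (a i)) (∑ i, ketbra (b i)) := by
  rw [← trace_columns_conjTranspose_mul, ← columns_mul_conjTranspose,
    ← columns_mul_conjTranspose]
  exact re_trace_le_rootFidelity _ _

theorem exists_sum_ketbra_re_sum_inner_eq {ρ : Matrix X X ℂ} (hρ : ρ.PosSemidef)
    (b : ι → Hilb X) :
    ∃ (a : ι → Hilb X) (c : X → Hilb X), ∑ i, ketbra (a i) + ∑ x, ketbra (c x) = ρ ∧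
      (∑ i, inner ℂ (a i) (b i)).re = rootFidelity ρ (∑ i, ketbra (b i)) := by
  obtain ⟨A, C, h1, h2⟩ := exists_factor_trace_eq_rootFidelity hρ (columns b)
  obtain ⟨a, rfl⟩ := exists_columns_eq A
  obtain ⟨c, rfl⟩ := exists_columns_eq C
  rw [columns_mul_conjTranspose, columns_mul_conjTranspose] at h1
  rw [trace_columns_conjTranspose_mul, columns_mul_conjTranspose] at h2
  exact ⟨a, c, h1, h2⟩

theorem ketbra_smul {X : Type*} [Fintype X] (c : ℂ) (v : Hilb X) :
    ketbra (c • v) = ((‖c‖ ^ 2 : ℝ) : ℂ) • ketbra v := by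
  ext x y
  simp only [ketbra, Matrix.of_apply, PiLp.smul_apply, smul_eq_mul, star_mul', Matrix.smul_apply]
  have : c * star c = ((‖c‖ ^ 2 : ℝ) : ℂ) := by
    simpa using Complex.mul_conj' c
  rw [← this]
  ring

theorem trace_ketbra {X : Type*} [Fintype X] (v : Hilb X) :
    (ketbra v).trace = ((‖v‖ ^ 2 : ℝ) : ℂ) := by
  rw [EuclideanSpace.norm_sq_eq]
  simp [Matrix.trace, ketbra, Complex.mul_conj']

theorem posSemidef_ketbra {X : Type*} [Fintype X] (v : Hilb X) : (ketbra v).PosSemidef :=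
  Matrix.posSemidef_vecMulVec_self_star (v : X → ℂ)

theorem ketbra_mul_ketbra_mul_ketbra {X : Type*} [Fintype X] (v w : Hilb X) :
    ketbra v * ketbra w * ketbra v = ((‖inner ℂ w v‖ ^ 2 : ℝ) : ℂ) • ketbra v := by
  have h : ((‖inner ℂ w v‖ ^ 2 : ℝ) : ℂ) = inner ℂ v w * inner ℂ w v := by
    rw [← inner_conj_symm v w, mul_comm]
    simpa using (Complex.mul_conj' (inner ℂ w v)).symm
  ext x y
  rw [h]
  simp only [ketbra, Matrix.mul_apply, Matrix.of_apply, Matrix.smul_apply, smul_eq_mul,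
    PiLp.inner_apply, Finset.sum_mul, Finset.mul_sum, RCLike.inner_apply, starRingEnd_apply]
  refine Finset.sum_congr rfl fun i _ => Finset.sum_congr rfl fun j _ => ?_
  ring

theorem ketbra_mul_self {X : Type*} [Fintype X] {v : Hilb X} (hv : ‖v‖ = 1) :
    ketbra v * ketbra v = ketbra v := by
  have h : ((inner ℂ v v : ℂ)) = 1 := by rw [inner_self_eq_norm_sq_to_K, hv]; simp
  ext x y
  simp only [ketbra, Matrix.mul_apply, Matrix.of_apply]
  calc ∑ j, v x * star (v j) * (v j * star (v y))
      = v x * (inner ℂ v v) * star (v y) := by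
        simp only [PiLp.inner_apply, Finset.sum_mul, Finset.mul_sum, RCLike.inner_apply,
          starRingEnd_apply]
        exact Finset.sum_congr rfl fun j _ => by ring
    _ = _ := by rw [h, mul_one]

/-- The fidelity of a pure state with a mixture of pure states is the mean overlap. -/
theorem fidelity_ketbra {v : Hilb X} (hv : ‖v‖ = 1) {q : ι → ℝ} (hq : ∀ i, 0 ≤ q i)
    (w : ι → Hilb X) :
    fidelity (ketbra v) (∑ i, (q i : ℂ) • ketbra (w i)) =
      ∑ i, q i * ‖inner ℂ (w i) v‖ ^ 2 := by
  set g := ∑ i, q i * ‖inner ℂ (w i) v‖ ^ 2 with hg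
  have hg0 : 0 ≤ g := Finset.sum_nonneg fun i _ => mul_nonneg (hq i) (sq_nonneg _)
  have h1 : CFC.sqrt (ketbra v) = ketbra v :=
    CFC.sqrt_unique (ketbra_mul_self hv) (posSemidef_ketbra v).nonneg
  have h2 : ketbra v * (∑ i, (q i : ℂ) • ketbra (w i)) * ketbra v = (g : ℂ) • ketbra v := by
    rw [Finset.mul_sum, Finset.sum_mul, hg, Complex.ofReal_sum, Finset.sum_smul]
    refine Finset.sum_congr rfl fun i _ => ?_
    rw [Matrix.mul_smul, Matrix.smul_mul, ketbra_mul_ketbra_mul_ketbra, smul_smul,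
      Complex.ofReal_mul]
  have h3 : CFC.sqrt ((g : ℂ) • ketbra v) = ((√g : ℝ) : ℂ) • ketbra v := by
    refine CFC.sqrt_unique ?_ ?_
    · rw [Matrix.smul_mul, Matrix.mul_smul, smul_smul, ketbra_mul_self hv, ← Complex.ofReal_mul,
        Real.mul_self_sqrt hg0]
    · exact ((posSemidef_ketbra v).smul (by exact_mod_cast Real.sqrt_nonneg g)).nonneg
  rw [fidelity, h1, h2, h3, Matrix.trace_smul, trace_ketbra, hv]
  simp [Real.sq_sqrt hg0]

/-- A state that is a sum of rank-one operators has a pure-state decomposition along the same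
vectors. -/
theorem exists_isPureDecomposition [Nonempty X] {ρ : Matrix X X ℂ} (hρ : ρ.trace = 1)
    (a : κ → Hilb X) (ha : ∑ k, ketbra (a k) = ρ) :
    ∃ (m : ℕ) (e : Fin m ≃ κ) (p : Fin m → ℝ) (ψ : Fin m → Hilb X),
      IsPureDecomposition ρ p ψ ∧ ∀ i, a (e i) = ((√(p i) : ℝ) : ℂ) • ψ i := by
  obtain ⟨u, hu⟩ : ∃ u : Hilb X, ‖u‖ = 1 :=
    ⟨EuclideanSpace.single (Classical.arbitrary X) 1, by simp⟩
  have hunit (v : Hilb X) : ∃ w : Hilb X, ‖w‖ = 1 ∧ v = ((‖v‖ : ℝ) : ℂ) • w := by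
    -- A zero vector has no direction; it gets the arbitrary unit vector `u`, with weight `0`.
    by_cases hv : v = 0
    · exact ⟨u, hu, by simp [hv]⟩
    · have hv' : ‖v‖ ≠ 0 := norm_ne_zero_iff.2 hv
      refine ⟨((‖v‖⁻¹ : ℝ) : ℂ) • v, ?_, ?_⟩
      · rw [norm_smul]; simp [hv']
      · rw [smul_smul, ← Complex.ofReal_mul, mul_inv_cancel₀ hv']; simp
  choose w hw hvw using hunit
  let e := (Fintype.equivFin κ).symm
  refine ⟨Fintype.card κ, e, fun i => ‖a (e i)‖ ^ 2, fun i => w (a (e i)),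
    ⟨fun i => sq_nonneg _, ?_, fun i => hw _, ?_⟩, fun i => ?_⟩
  · rw [e.sum_comp fun k => ‖a k‖ ^ 2]
    have := congrArg Matrix.trace ha
    rw [hρ, Matrix.trace_sum] at this
    simp only [trace_ketbra] at this
    exact_mod_cast this
  · rw [e.sum_comp fun k => ((‖a k‖ ^ 2 : ℝ) : ℂ) • ketbra (w (a k)), ← ha]
    refine Finset.sum_congr rfl fun k _ => ?_
    conv_lhs => rw [hvw (a k), ketbra_smul]
    simp
  · rw [Real.sqrt_sq (norm_nonneg _)]
    exact hvw _

end Vectors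

/-! ### Separable states and the two inequalities -/

section Multipartite

variable {n : ℕ} {d : Fin n → Type*} [∀ j, Fintype (d j)]

/-- The tensor product of one vector for each party. -/
noncomputable def tensorVec {n : ℕ} {d : Fin n → Type*} [∀ j, Fintype (d j)]
    (φ : ∀ j, Hilb (d j)) : Hilb (∀ j, d j) :=
  WithLp.toLp 2 fun x => ∏ j, φ j (x j)

theorem ketbra_tensorVec (φ : ∀ j, Hilb (d j)) :
    ketbra (tensorVec φ) = tensorOp fun j => ketbra (φ j) := by
  ext x y
  simp [ketbra, tensorVec, tensorOp, Finset.prod_mul_distrib]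

/-- The pure product states. -/
def pureProducts (d : Fin n → Type*) [∀ j, Fintype (d j)] :
    Set (Matrix (∀ j, d j) (∀ j, d j) ℂ) :=
  (fun φ : ∀ j, Hilb (d j) => tensorOp fun j => ketbra (φ j)) ''
    Set.univ.pi fun _ => Metric.sphere 0 1

theorem isSeparable_iff_mem_convexHull {σ : Matrix (∀ j, d j) (∀ j, d j) ℂ} :
    IsSeparable σ ↔ σ ∈ convexHull ℝ (pureProducts d) := by
  constructor
  · rintro ⟨m, q, φ, hq, hq1, hφ, rfl⟩
    refine mem_convexHull_of_exists_fintype q (fun i => tensorOp fun j => ketbra (φ i j)) hq hq1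
      (fun i => ⟨φ i, fun j _ => by simp [hφ], rfl⟩) ?_
    simp
  · rw [mem_convexHull_iff_exists_fintype]
    rintro ⟨ι, _, q, z, hq, hq1, hz, rfl⟩
    choose φ hφ hz using hz
    let e := (Fintype.equivFin ι).symm
    refine ⟨Fintype.card ι, fun i => q (e i), fun i => φ (e i), fun i => hq _,
      (e.sum_comp q).trans hq1, fun i j => by simpa using hφ (e i) j trivial, ?_⟩
    rw [e.sum_comp fun i => (q i : ℂ) • tensorOp fun j => ketbra (φ i j)]
    refine Finset.sum_congr rfl fun i _ => ?_
    rw [← hz]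
    simp

theorem isCompact_pureProducts : IsCompact (pureProducts d) := by
  refine (isCompact_univ_pi fun j => isCompact_sphere 0 1).image ?_
  refine continuous_matrix fun x y => ?_
  simp only [tensorOp, ketbra, Matrix.of_apply]
  fun_prop

theorem isCompact_setOf_isSeparable :
    IsCompact {σ : Matrix (∀ j, d j) (∀ j, d j) ℂ | IsSeparable σ} := by
  simp only [isSeparable_iff_mem_convexHull]
  exact isCompact_pureProducts.convexHull_of_finiteDimensional

theorem IsSeparable.posSemidef {σ : Matrix (∀ j, d j) (∀ j, d j) ℂ} (h : IsSeparable σ) :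
    σ.PosSemidef := by
  obtain ⟨m, q, φ, hq, -, -, rfl⟩ := h
  refine Matrix.posSemidef_sum _ fun i _ => ?_
  rw [← ketbra_tensorVec]
  exact (posSemidef_ketbra _).smul (by exact_mod_cast hq i)

theorem isSeparable_ketbra_tensorVec {φ : ∀ j, Hilb (d j)} (hφ : ∀ j, ‖φ j‖ = 1) :
    IsSeparable (ketbra (tensorVec φ)) :=
  ⟨1, fun _ => 1, fun _ => φ, by simp, by simp, fun _ => hφ, by simp [ketbra_tensorVec]⟩

theorem IsDensity.nonempty {X : Type*} [Fintype X] {ρ : Matrix X X ℂ}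
    (hρ : IsDensity ρ) : Nonempty X := by
  by_contra h
  rw [not_nonempty_iff] at h
  simpa [Matrix.trace] using hρ.2

variable [∀ j, DecidableEq (d j)]

theorem isGreatest_sepFidelities [Nonempty (∀ j, d j)] (ρ : Matrix (∀ j, d j) (∀ j, d j) ℂ) :
    IsGreatest (sepFidelities ρ) (fidelityOfSeparability ρ) := by
  have himage : sepFidelities ρ = fidelity ρ '' {σ | IsSeparable σ} := by
    ext v
    simp [sepFidelities, eq_comm]
  refine IsCompact.isGreatest_sSup ?_ ?_
  · rw [himage]
    exact isCompact_setOf_isSeparable.image_of_continuousOn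
      ((continuousOn_fidelity ρ).mono fun σ hσ => IsSeparable.posSemidef hσ)
  · let x : ∀ j, d j := Classical.arbitrary _
    exact ⟨_, _, isSeparable_ketbra_tensorVec
      (φ := fun j => EuclideanSpace.single (x j) 1) (by simp), rfl⟩

theorem fidelityOfSeparability_nonneg [Nonempty (∀ j, d j)]
    (ρ : Matrix (∀ j, d j) (∀ j, d j) ℂ) : 0 ≤ fidelityOfSeparability ρ := by
  obtain ⟨σ, -, h⟩ := (isGreatest_sepFidelities ρ).1
  rw [h]
  exact sq_nonneg _

theorem norm_inner_sq_le_fidelityOfSeparability [Nonempty (∀ j, d j)] {ψ : Hilb (∀ j, d j)}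
    (hψ : ‖ψ‖ = 1) {φ : ∀ j, Hilb (d j)} (hφ : ∀ j, ‖φ j‖ = 1) :
    ‖inner ℂ (tensorVec φ) ψ‖ ^ 2 ≤ fidelityOfSeparability (ketbra ψ) := by
  refine (isGreatest_sepFidelities (ketbra ψ)).2 ⟨_, isSeparable_ketbra_tensorVec hφ, ?_⟩
  have := fidelity_ketbra hψ (ι := Unit) (q := fun _ => 1) (by simp) fun _ => tensorVec φ
  simpa using this.symm

/-- For a pure state the fidelity of separability is attained at a pure product state. -/
theorem exists_norm_inner_sq_eq_fidelityOfSeparability [Nonempty (∀ j, d j)]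
    {ψ : Hilb (∀ j, d j)} (hψ : ‖ψ‖ = 1) :
    ∃ φ : ∀ j, Hilb (d j), (∀ j, ‖φ j‖ = 1) ∧
      ‖inner ℂ (tensorVec φ) ψ‖ ^ 2 = fidelityOfSeparability (ketbra ψ) := by
  obtain ⟨_, ⟨m, q, φ, hq, hq1, hφ, rfl⟩, hF⟩ := (isGreatest_sepFidelities (ketbra ψ)).1
  simp only [← ketbra_tensorVec, fidelity_ketbra hψ hq] at hF
  -- The maximum is a weighted mean of overlaps, so they cannot all lie strictly below it.
  by_contra! hne
  have hlt (i : Fin m) : ‖inner ℂ (tensorVec (φ i)) ψ‖ ^ 2 < fidelityOfSeparability (ketbra ψ) :=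
    (norm_inner_sq_le_fidelityOfSeparability hψ (hφ i)).lt_of_ne (hne _ (hφ i))
  obtain ⟨i, hi⟩ : ∃ i, 0 < q i := by
    by_contra! h
    exact absurd (hq1.symm.le.trans (Finset.sum_nonpos fun i _ => h i)) (by norm_num)
  have : ∑ i, q i * ‖inner ℂ (tensorVec (φ i)) ψ‖ ^ 2 <
      ∑ i, q i * fidelityOfSeparability (ketbra ψ) :=
    Finset.sum_lt_sum (fun i _ => mul_le_mul_of_nonneg_left (hlt i).le (hq i))
      ⟨i, Finset.mem_univ i, mul_lt_mul_of_pos_left (hlt i) hi⟩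
  rw [← hF, ← Finset.sum_mul, hq1, one_mul] at this
  exact this.false

/-- The mean fidelity of separability of a pure-state decomposition is at most that of the
mixture. -/
theorem sum_le_fidelityOfSeparability [Nonempty (∀ j, d j)]
    {ρ : Matrix (∀ j, d j) (∀ j, d j) ℂ} {m : ℕ} {p : Fin m → ℝ}
    {ψ : Fin m → Hilb (∀ j, d j)} (h : IsPureDecomposition ρ p ψ) :
    ∑ i, p i * fidelityOfSeparability (ketbra (ψ i)) ≤ fidelityOfSeparability ρ := by
  choose φ hφ hφψ using fun i => exists_norm_inner_sq_eq_fidelityOfSeparability (h.norm_eq_one i)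
  simp only [← hφψ]
  set z : Fin m → ℂ := fun i => inner ℂ (tensorVec (φ i)) (ψ i) with hz
  set G := ∑ i, p i * ‖z i‖ ^ 2 with hG
  have hterm (i : Fin m) : 0 ≤ p i * ‖z i‖ ^ 2 := mul_nonneg (h.nonneg i) (sq_nonneg _)
  have hG0 : 0 ≤ G := Finset.sum_nonneg fun i _ => hterm i
  rcases hG0.eq_or_lt with h0 | hpos
  · rw [← h0]
    exact fidelityOfSeparability_nonneg ρ
  -- These weights are the equality case of Cauchy–Schwarz for `∑ √(p i * q i) * ‖z i‖`.
  set q : Fin m → ℝ := fun i => p i * ‖z i‖ ^ 2 / G with hq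
  have hsep : IsSeparable (∑ i, (q i : ℂ) • tensorOp fun j => ketbra (φ i j)) := by
    refine ⟨m, q, φ, fun i => div_nonneg (hterm i) hpos.le, ?_, hφ, rfl⟩
    rw [hq, ← Finset.sum_div, div_self hpos.ne']
  refine le_trans ?_ ((isGreatest_sepFidelities ρ).2 ⟨_, hsep, rfl⟩)
  let a : Fin m → Hilb (∀ j, d j) := fun i => ((√(p i) : ℝ) : ℂ) • ψ i
  -- The factor `z i` supplies both the modulus for the weight `q i` and the phase making `⟨a i, b
  -- i⟩` nonnegative.
  let b : Fin m → Hilb (∀ j, d j) :=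
    fun i => (((√(p i) / √G : ℝ) : ℂ) * z i) • tensorVec (φ i)
  have ha : ∑ i, ketbra (a i) = ρ := by
    rw [h.eq_sum]
    refine Finset.sum_congr rfl fun i _ => ?_
    rw [ketbra_smul]
    simp [Real.sq_sqrt (h.nonneg i)]
  have hb : ∑ i, ketbra (b i) = ∑ i, (q i : ℂ) • tensorOp fun j => ketbra (φ i j) := by
    refine Finset.sum_congr rfl fun i _ => ?_
    rw [ketbra_smul, ketbra_tensorVec, norm_mul, mul_pow, Complex.norm_real, Real.norm_eq_abs,
      sq_abs, div_pow, Real.sq_sqrt (h.nonneg i), Real.sq_sqrt hpos.le, hq, div_mul_eq_mul_div]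
  have hab : (∑ i, inner ℂ (a i) (b i)).re = √G := by
    have hi (i : Fin m) : inner ℂ (a i) (b i) = ((p i * ‖z i‖ ^ 2 / √G : ℝ) : ℂ) := by
      have h1 : z i * inner ℂ (ψ i) (tensorVec (φ i)) = ((‖z i‖ ^ 2 : ℝ) : ℂ) := by
        rw [show inner ℂ (ψ i) (tensorVec (φ i)) = starRingEnd ℂ (z i) from
          (inner_conj_symm _ _).symm, Complex.mul_conj', Complex.ofReal_pow]
      have h2 : √(p i) * (√(p i) / √G) = p i / √G := by
        rw [← mul_div_assoc, Real.mul_self_sqrt (h.nonneg i)]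
      rw [inner_smul_left, inner_smul_right, Complex.conj_ofReal, mul_assoc, h1,
        ← Complex.ofReal_mul, ← Complex.ofReal_mul, ← mul_assoc, h2, div_mul_eq_mul_div]
    simp only [hi]
    rw [← Complex.ofReal_sum, Complex.ofReal_re, ← Finset.sum_div, ← hG, Real.div_sqrt]
  have hle := re_sum_inner_le_rootFidelity a b
  rw [ha, hb, hab] at hle
  rw [fidelity_eq_sq]
  calc G = √G ^ 2 := (Real.sq_sqrt hpos.le).symm
    _ ≤ _ := pow_le_pow_left₀ (Real.sqrt_nonneg _) hle 2

/-- Some pure-state decomposition reaches the fidelity of separability. -/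
theorem exists_fidelityOfSeparability_le_sum [Nonempty (∀ j, d j)]
    {ρ : Matrix (∀ j, d j) (∀ j, d j) ℂ} (hρ : IsDensity ρ) :
    ∃ (m : ℕ) (p : Fin m → ℝ) (ψ : Fin m → Hilb (∀ j, d j)), IsPureDecomposition ρ p ψ ∧
      fidelityOfSeparability ρ ≤ ∑ i, p i * fidelityOfSeparability (ketbra (ψ i)) := by
  obtain ⟨_, ⟨m, q, φ, hq, hq1, hφ, rfl⟩, hF⟩ := (isGreatest_sepFidelities ρ).1
  obtain ⟨a, c, hac, hab⟩ := exists_sum_ketbra_re_sum_inner_eq hρ.1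
    fun i => ((√(q i) : ℝ) : ℂ) • tensorVec (φ i)
  have hb : ∑ i, ketbra (((√(q i) : ℝ) : ℂ) • tensorVec (φ i)) =
      ∑ i, (q i : ℂ) • tensorOp fun j => ketbra (φ i j) := by
    refine Finset.sum_congr rfl fun i _ => ?_
    rw [ketbra_smul, ketbra_tensorVec]
    simp [Real.sq_sqrt (hq i)]
  rw [hb] at hab
  obtain ⟨M, e, p, ψ, hdec, hψ⟩ := exists_isPureDecomposition hρ.2 (Sum.elim a c)
    (by simpa [Fintype.sum_sum_type] using hac)
  refine ⟨M, p, ψ, hdec, ?_⟩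
  have hroot : rootFidelity ρ (∑ i, (q i : ℂ) • tensorOp fun j => ketbra (φ i j)) ≤
      ∑ i, √(q i) * ‖inner ℂ (tensorVec (φ i)) (a i)‖ := by
    rw [← hab, Complex.re_sum]
    refine Finset.sum_le_sum fun i _ => (Complex.re_le_norm _).trans_eq ?_
    rw [inner_smul_right, norm_mul, norm_inner_symm, Complex.norm_real, Real.norm_eq_abs,
      abs_of_nonneg (Real.sqrt_nonneg _)]
  calc fidelityOfSeparability ρ
      ≤ (∑ i, √(q i) * ‖inner ℂ (tensorVec (φ i)) (a i)‖) ^ 2 := by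
        rw [hF, fidelity_eq_sq]
        exact pow_le_pow_left₀ (rootFidelity_nonneg _ _) hroot 2
    _ ≤ (∑ i, √(q i) ^ 2) * ∑ i, ‖inner ℂ (tensorVec (φ i)) (a i)‖ ^ 2 :=
        Finset.sum_mul_sq_le_sq_mul_sq _ _ _
    _ = ∑ i, ‖inner ℂ (tensorVec (φ i)) (a i)‖ ^ 2 := by
        simp only [Real.sq_sqrt (hq _), hq1, one_mul]
    _ ≤ ∑ i, p (e.symm (.inl i)) * fidelityOfSeparability (ketbra (ψ (e.symm (.inl i)))) := by
        refine Finset.sum_le_sum fun i _ => ?_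
        have hai := hψ (e.symm (.inl i))
        rw [e.apply_symm_apply, Sum.elim_inl] at hai
        rw [hai, inner_smul_right, norm_mul, mul_pow, Complex.norm_real, Real.norm_eq_abs, sq_abs,
          Real.sq_sqrt (hdec.nonneg _)]
        exact mul_le_mul_of_nonneg_left
          (norm_inner_sq_le_fidelityOfSeparability (hdec.norm_eq_one _) (hφ i)) (hdec.nonneg _)
    -- The members coming from `c` have no partner in `σ` and only add nonnegative terms.
    _ ≤ ∑ k, p (e.symm k) * fidelityOfSeparability (ketbra (ψ (e.symm k))) := by
        rw [Fintype.sum_sum_type]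
        exact le_add_of_nonneg_right <| Finset.sum_nonneg fun x _ =>
          mul_nonneg (hdec.nonneg _) (fidelityOfSeparability_nonneg _)
    _ = ∑ i, p i * fidelityOfSeparability (ketbra (ψ i)) :=
        e.symm.sum_comp fun i => p i * fidelityOfSeparability (ketbra (ψ i))

end Multipartite

end QSep

theorem theorem1 {n : ℕ} {d : Fin n → Type*} [∀ j, Fintype (d j)] [∀ j, DecidableEq (d j)]
    (ρ : Matrix (∀ j, d j) (∀ j, d j) ℂ) (hρ : QSep.IsDensity ρ) :
    IsGreatest (QSep.sepFidelities ρ) (QSep.fidelityOfSeparability ρ) ∧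
    IsGreatest (QSep.decompositionValues ρ) (QSep.fidelityOfSeparability ρ) := by
  have := hρ.nonempty
  refine ⟨QSep.isGreatest_sepFidelities ρ, ?_, ?_⟩
  · obtain ⟨m, p, ψ, h, hle⟩ := QSep.exists_fidelityOfSeparability_le_sum hρ
    exact ⟨m, p, ψ, h, hle.antisymm (QSep.sum_le_fidelityOfSeparability h)⟩
  · rintro _ ⟨m, p, ψ, h, rfl⟩
    exact QSep.sum_le_fidelityOfSeparability h
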